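/- **Theorem 3.1.** Let $\alpha,\beta\in(0,1)$ satisfy $2\beta+\alpha<1-e^{-1/36}$. There is a constant $C>0$, depending only on $\alpha$ and $\beta$, such that the following holds for every $n\in\mathbb{N}$, every $\eta\in[0,1)$ and every $\tau\ge 0$. Put $I=[\sqrt{1-\eta}\,\tau,\tau]$ and, for $f\in\mathbb{R}^n$ and $\sigma\in I$, let $\mathbb{P}_{f,\sigma}$ be the law of $Y=f+\sigma\varepsilon$, where $\varepsilon=(\varepsilon_1,\dots,\varepsilon_n)$ has i.i.d. standard Gaussian coordinates. Let $(\tilde f,\tilde r)$ be a measurable function of $Y$ only, with values in $\mathbb{R}^n\times\mathbb{R}_+$, such that for all $f\in\mathbb{R}^n$ and all $\sigma\in I$ $$\mathbb{P}_{f,\sigma}\big[f\in\mathcal{B}(\tilde f,\tilde r)\big]\ge 1-\beta ,$$ where $\mathcal{B}(x,r)$ is the closed Euclidean ball with centre $x$ and radius $r$. 1. Let $S_m$ be any linear subspace of $\mathbb{R}^n$ (in particular, any member of a finite family $\{S_m,\ m\in\mathcal{M}_n\}$ of linear subspaces), and put $\mathcal{D}_m=\dim S_m$ and $N_m=n-\mathcal{D}_m$.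 If $r_m\in\mathbb{R}$ satisfies $\inf_{f\in S_m}\mathbb{P}_{f,\sigma}[\tilde r\le r_m]\ge 1-\alpha$ for all $\sigma\in I$, then $$r_m^2\ge C\max\{\eta N_m,\ \mathcal{D}_m,\ \sqrt{N_m}\}\,\tau^2 .$$ 2. Let $f\in\mathbb{R}^n$. If $r(\alpha,f)\in\mathbb{R}$ satisfies $\mathbb{P}_{f,\sigma}[\tilde r\le r(\alpha,f)]\ge 1-\alpha$ for all $\sigma\in I$, then $$r^2(\alpha,f)\ge C\max\{\eta n,\ \sqrt{n}\}\,\tau^2 .$$ -/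

import Mathlib

open MeasureTheory ProbabilityTheory
open scoped NNReal

/-- The law `P_{f,σ}` of `Y = f + σ ε`, where `ε` is a standard Gaussian vector of `ℝⁿ`
(its coordinates are i.i.d. standard Gaussian random variables). -/
noncomputable def regressionLaw {n : ℕ} (f : EuclideanSpace ℝ (Fin n)) (σ : ℝ) :
    Measure (EuclideanSpace ℝ (Fin n)) :=
  (stdGaussian (EuclideanSpace ℝ (Fin n))).map (fun e => f + σ • e)

instance isProbabilityMeasure_regressionLaw {n : ℕ} (f : EuclideanSpace ℝ (Fin n)) (σ : ℝ) :
    IsProbabilityMeasure (regressionLaw f σ) :=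
  Measure.isProbabilityMeasure_map (by fun_prop)

/-- The interval `I = [√(1-η) τ, τ]` to which the noise level is known to belong. -/
noncomputable def noiseInterval (η τ : ℝ) : Set ℝ :=
  Set.Icc (Real.sqrt (1 - η) * τ) τ

/-- The (closed) Euclidean ball with centre `ftilde(Y)` and radius `rtilde(Y)` has coverage
probability at least `1 - β`, uniformly over all `f ∈ ℝⁿ` and all `σ ∈ I`. -/
def HasCoverage {n : ℕ} (η τ β : ℝ)
    (ftilde : EuclideanSpace ℝ (Fin n) → EuclideanSpace ℝ (Fin n))
    (rtilde : EuclideanSpace ℝ (Fin n) → ℝ≥0) : Prop :=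
  ∀ f : EuclideanSpace ℝ (Fin n), ∀ σ ∈ noiseInterval η τ,
    1 - β ≤ (regressionLaw f σ).real {y | f ∈ Metric.closedBall (ftilde y) (rtilde y : ℝ)}

/-!
All bounds come from Gaussian priors on the mean, and `C = 1/160` works. Since
`1 - exp(-1/36) ≤ 1/36`, the numbers `α` and `β` are small. Let `A` be the event that the
confidence ball contains `f` and has radius at most `r`; it has probability at least `1 - α - β`
under `P_{f,τ}`.

*The terms `η n` and `√n`.* Replace the mean by `f + a ξ` with `ξ` standard Gaussian, with noise
level `σ ∈ I`. The observation is then distributed as `f` plus noise of level `√(a² + σ²)`. On `A`,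
coverage of the true mean forces `‖a ξ‖ ≤ 2 r`, so that `A` has probability at most
`β + P(‖a ξ‖ ≤ 2 r)` under this law (`stdGaussian_real_goodSet_le`). The last probability is at
most `3/4` if `80 r² < a² n` (`stdGaussian_mul_norm_sq_le`), so `r` cannot be this small if `A` is
likely under noise of level `√(a² + σ²)` as well. With `a = √η τ` and `σ = √(1 - η) τ` that level
is `τ`, and `A` is likely by assumption. With `σ = τ` and `a² = τ² / (2 √n)` the
second moment of the likelihood ratio to the law with level `τ` is bounded
(`stdGaussian_real_preimage_smul_le`), so the complement of `A` remains unlikely.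

*The term `dim S`.* Let `P` be the orthogonal projection onto `S` and let `x`, `e` be independent
standard Gaussian vectors. The observation `τ P x + τ e` has mean `τ P x ∈ S`. Exchanging the
`S`-components of `x` and `e` preserves the joint law and the observation, but turns the mean into
`τ P e` (`map_swapComponents_stdGaussian_prod`, `starProjection_fst_add_snd_swapComponents`). Hence
with probability at least `1 - 2 (α + β)` both means lie in one ball of radius at most `r`, so
`τ ‖P (x - e)‖ ≤ 2 r`, whereas `P (x - e)` is `√2` times a standard Gaussian vector of `S`.
-/

/-! ### Linear images of pairs of independent Gaussian vectors -/

section GaussianCalculus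

variable {E : Type*} [NormedAddCommGroup E] [InnerProductSpace ℝ E] [FiniteDimensional ℝ E]
  [MeasurableSpace E] [BorelSpace E]

lemma charFunDual_stdGaussian_prod_self (L : StrongDual ℝ (E × E)) :
    charFunDual ((stdGaussian E).prod (stdGaussian E)) L =
      Complex.exp (-((‖L.comp (.inl ℝ E E)‖ ^ 2 + ‖L.comp (.inr ℝ E E)‖ ^ 2 : ℝ) : ℂ) / 2) := by
  rw [charFunDual_prod, charFunDual_stdGaussian, charFunDual_stdGaussian, ← Complex.exp_add]
  congr 1
  push_cast
  ring

/-- A Gaussian prior on the mean is indistinguishable from additional noise. -/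
lemma map_smul_add_smul_stdGaussian_prod (a b : ℝ) :
    ((stdGaussian E).prod (stdGaussian E)).map (fun p => a • p.1 + b • p.2) =
      (stdGaussian E).map (fun e => √(a ^ 2 + b ^ 2) • e) := by
  apply Measure.ext_of_charFunDual
  ext L
  have h1 : (fun p : E × E => a • p.1 + b • p.2) =
      ⇑(a • ContinuousLinearMap.fst ℝ E E + b • ContinuousLinearMap.snd ℝ E E) := rfl
  have h2 : (fun e : E => √(a ^ 2 + b ^ 2) • e) =
      ⇑(√(a ^ 2 + b ^ 2) • ContinuousLinearMap.id ℝ E) := rfl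
  rw [h1, h2, charFunDual_map, charFunDual_map, charFunDual_stdGaussian_prod_self,
    charFunDual_stdGaussian]
  have e1 : (L.comp (a • ContinuousLinearMap.fst ℝ E E + b • ContinuousLinearMap.snd ℝ E E)).comp
      (.inl ℝ E E) = a • L := by ext; simp
  have e2 : (L.comp (a • ContinuousLinearMap.fst ℝ E E + b • ContinuousLinearMap.snd ℝ E E)).comp
      (.inr ℝ E E) = b • L := by ext; simp
  have e3 : L.comp (√(a ^ 2 + b ^ 2) • ContinuousLinearMap.id ℝ E) = √(a ^ 2 + b ^ 2) • L := by
    ext; simp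
  rw [e1, e2, e3]
  simp only [norm_smul, mul_pow, Real.norm_eq_abs, sq_abs]
  have := Real.sq_sqrt (show 0 ≤ a ^ 2 + b ^ 2 by positivity)
  rw [← Complex.ofReal_pow (_ * _), mul_pow, sq_abs, this, add_mul]

/-- The map of `E × E` exchanging the `S`-components of the two entries and keeping their
`Sᗮ`-components in place. -/
noncomputable def swapComponents (S : Submodule ℝ E) : E × E →L[ℝ] E × E :=
  ((S.starProjection.comp (.snd ℝ E E)) + (Sᗮ.starProjection.comp (.fst ℝ E E))).prod
    ((S.starProjection.comp (.fst ℝ E E)) + (Sᗮ.starProjection.comp (.snd ℝ E E)))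

omit [MeasurableSpace E] [BorelSpace E] in
lemma swapComponents_apply (S : Submodule ℝ E) (p : E × E) :
    swapComponents S p = (S.starProjection p.2 + Sᗮ.starProjection p.1,
      S.starProjection p.1 + Sᗮ.starProjection p.2) := rfl

omit [MeasurableSpace E] [BorelSpace E] in
lemma norm_sq_starProjection_add_starProjection_orthogonal (S : Submodule ℝ E) (u v : E) :
    ‖S.starProjection u + Sᗮ.starProjection v‖ ^ 2 =
      ‖S.starProjection u‖ ^ 2 + ‖Sᗮ.starProjection v‖ ^ 2 := by
  have h : inner ℝ (S.starProjection u) (Sᗮ.starProjection v) = 0 :=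
    Submodule.inner_right_of_mem_orthogonal (Submodule.starProjection_apply_mem _ _)
      (Submodule.starProjection_apply_mem _ _)
  rw [norm_add_sq_real, h]
  ring

omit [MeasurableSpace E] [BorelSpace E] in
lemma starProjection_fst_swapComponents (S : Submodule ℝ E) (p : E × E) :
    S.starProjection (swapComponents S p).1 = S.starProjection p.2 := by
  rw [swapComponents_apply, map_add,
    Submodule.starProjection_eq_self_iff.2 (S.starProjection_apply_mem p.2),
    (S.starProjection_apply_eq_zero_iff).2 (Sᗮ.starProjection_apply_mem p.1), add_zero]

omit [MeasurableSpace E] [BorelSpace E] in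
/-- With mean `P p.1`, where `P` is the projection onto `S`, and noise `p.2`, exchanging the
`S`-components of `p.1` and `p.2` leaves the observation unchanged while it replaces the mean
`P p.1` by `P p.2`. -/
lemma starProjection_fst_add_snd_swapComponents (S : Submodule ℝ E) (p : E × E) :
    S.starProjection (swapComponents S p).1 + (swapComponents S p).2 =
      S.starProjection p.1 + p.2 := by
  rw [starProjection_fst_swapComponents]
  simp only [swapComponents_apply, Submodule.starProjection_orthogonal_val]
  module

lemma map_swapComponents_stdGaussian_prod (S : Submodule ℝ E) :
    ((stdGaussian E).prod (stdGaussian E)).map (swapComponents S) =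
      (stdGaussian E).prod (stdGaussian E) := by
  apply Measure.ext_of_charFunDual
  ext L
  rw [charFunDual_map, charFunDual_stdGaussian_prod_self, charFunDual_stdGaussian_prod_self]
  obtain ⟨u, hu⟩ := (InnerProductSpace.toDual ℝ E).surjective (L.comp (.inl ℝ E E))
  obtain ⟨v, hv⟩ := (InnerProductSpace.toDual ℝ E).surjective (L.comp (.inr ℝ E E))
  have hL (x y : E) : L (x, y) = inner ℝ u x + inner ℝ v y := by
    have h1 : L (x, 0) = inner ℝ u x := by
      have := DFunLike.congr_fun hu x
      simpa using this.symm
    have h2 : L (0, y) = inner ℝ v y := by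
      have := DFunLike.congr_fun hv y
      simpa using this.symm
    rw [← h1, ← h2, ← map_add]
    simp
  have e1 : (L.comp (swapComponents S)).comp (.inl ℝ E E) =
      InnerProductSpace.toDual ℝ E (S.starProjection v + Sᗮ.starProjection u) := by
    ext x
    simp only [ContinuousLinearMap.comp_apply, ContinuousLinearMap.inl_apply,
      swapComponents_apply, hL, map_zero, zero_add, add_zero,
      InnerProductSpace.toDual_apply_apply, inner_add_left,
      Submodule.inner_starProjection_left_eq_right]
    ring
  have e2 : (L.comp (swapComponents S)).comp (.inr ℝ E E) =
      InnerProductSpace.toDual ℝ E (S.starProjection u + Sᗮ.starProjection v) := by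
    ext x
    simp only [ContinuousLinearMap.comp_apply, ContinuousLinearMap.inr_apply,
      swapComponents_apply, hL, map_zero, zero_add, add_zero,
      InnerProductSpace.toDual_apply_apply, inner_add_left,
      Submodule.inner_starProjection_left_eq_right]
  rw [e1, e2, ← hu, ← hv]
  simp only [LinearIsometryEquiv.norm_map, norm_sq_starProjection_add_starProjection_orthogonal]
  rw [S.norm_sq_eq_add_norm_sq_starProjection u, S.norm_sq_eq_add_norm_sq_starProjection v]
  congr 4
  ring

lemma map_orthogonalProjectionOnto_stdGaussian (S : Submodule ℝ E) :
    (stdGaussian E).map S.orthogonalProjectionOnto = stdGaussian S := by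
  apply Measure.ext_of_charFunDual
  ext L
  rw [charFunDual_map, charFunDual_stdGaussian, charFunDual_stdGaussian]
  congr 5
  refine le_antisymm ?_ (L.opNorm_le_bound (norm_nonneg _) fun x => ?_)
  · calc _ ≤ ‖L‖ * ‖S.orthogonalProjectionOnto‖ := L.opNorm_comp_le _
      _ ≤ ‖L‖ * 1 := by gcongr; exact S.orthogonalProjectionOnto_norm_le
      _ = ‖L‖ := mul_one _
  · simpa using (L.comp S.orthogonalProjectionOnto).le_opNorm (x : E)

end GaussianCalculus

/-! ### Small balls -/

/-- At and below `b = -1/2` the integral diverges, and both sides are zero by convention. -/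
lemma integral_exp_neg_mul_sq_gaussianReal (b : ℝ) :
    ∫ x, Real.exp (-b * x ^ 2) ∂(gaussianReal 0 1) = √(1 / (1 + 2 * b)) := by
  rw [integral_gaussianReal_eq_integral_smul one_ne_zero]
  have (x : ℝ) : gaussianPDFReal 0 1 x • Real.exp (-b * x ^ 2) =
      (√(2 * Real.pi))⁻¹ * Real.exp (-(1 / 2 + b) * x ^ 2) := by
    simp only [gaussianPDFReal, NNReal.coe_one, mul_one, sub_zero, smul_eq_mul, mul_assoc,
      ← Real.exp_add]
    congr 2
    ring
  simp_rw [this, integral_const_mul, integral_gaussian, ← Real.sqrt_inv]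
  rw [← Real.sqrt_mul (by positivity)]
  congr 1
  have : (1 / 2 + b) = (1 + 2 * b) / 2 := by ring
  rw [this]
  have := Real.pi_pos.ne'
  rcases eq_or_ne (1 + 2 * b) 0 with h | h
  · simp [h]
  field_simp

section SmallBall

variable {E : Type*} [NormedAddCommGroup E] [InnerProductSpace ℝ E] [FiniteDimensional ℝ E]
  [MeasurableSpace E] [BorelSpace E]

lemma integral_exp_neg_half_norm_sq_stdGaussian :
    ∫ x, Real.exp (-(1 / 2) * ‖x‖ ^ 2) ∂(stdGaussian E) = √(1 / 2) ^ Module.finrank ℝ E := by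
  rw [stdGaussian, integral_map (Measurable.aemeasurable (by fun_prop))
    (Measurable.aestronglyMeasurable (by fun_prop))]
  have (x : Fin (Module.finrank ℝ E) → ℝ) :
      Real.exp (-(1 / 2) * ‖∑ i, x i • stdOrthonormalBasis ℝ E i‖ ^ 2) =
        ∏ i, Real.exp (-(1 / 2) * x i ^ 2) := by
    rw [← Real.exp_sum, ← Finset.mul_sum, ← (stdOrthonormalBasis ℝ E).sum_sq_inner_right]
    congr 3 with i
    rw [(stdOrthonormalBasis ℝ E).orthonormal.inner_right_fintype]
  simp_rw [this]
  rw [integral_fintype_prod_eq_pow (fun t : ℝ => Real.exp (-(1 / 2) * t ^ 2)),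
    integral_exp_neg_mul_sq_gaussianReal, Fintype.card_fin]
  norm_num

/-- Chernoff's bound `P(‖x‖² ≤ d/20) ≤ exp(d/40) E exp(-‖x‖²/2) = (exp(1/40)/√2)^d`, with a
bound on the right that does not depend on the dimension `d ≥ 1`. -/
lemma stdGaussian_norm_sq_le_finrank (hE : 0 < Module.finrank ℝ E) :
    (stdGaussian E).real {x | ‖x‖ ^ 2 ≤ Module.finrank ℝ E / 20} ≤ 3 / 4 := by
  set d := Module.finrank ℝ E
  have hm : Real.exp (-(d / 40 : ℝ)) * (stdGaussian E).real {x | ‖x‖ ^ 2 ≤ (d : ℝ) / 20} ≤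
      √(1 / 2) ^ d := by
    rw [← integral_exp_neg_half_norm_sq_stdGaussian]
    have hint : Integrable (fun x : E => Real.exp (-(1 / 2) * ‖x‖ ^ 2)) (stdGaussian E) := by
      refine Integrable.of_bound (Measurable.aestronglyMeasurable (by fun_prop)) 1 (ae_of_all _ ?_)
      intro x
      rw [Real.norm_eq_abs, abs_of_pos (Real.exp_pos _), Real.exp_le_one_iff]
      nlinarith [sq_nonneg ‖x‖]
    refine le_trans ?_ (mul_meas_ge_le_integral_of_nonneg
      (ae_of_all _ fun x => (Real.exp_pos _).le) hint (Real.exp (-(d / 40 : ℝ))))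
    refine mul_le_mul_of_nonneg_left (measureReal_mono ?_) (Real.exp_pos _).le
    intro x (hx : ‖x‖ ^ 2 ≤ (d : ℝ) / 20)
    exact Real.exp_le_exp.2 (by linarith)
  have h1 : Real.exp (1 / 40 : ℝ) ≤ 40 / 39 := by
    have := Real.add_one_le_exp (-(1 / 40) : ℝ)
    rw [Real.exp_neg] at this
    rw [← inv_inv (Real.exp _)]
    exact (inv_anti₀ (by norm_num) this).trans (by norm_num)
  have h2 : √(1 / 2 : ℝ) ≤ 71 / 100 := Real.sqrt_le_iff.2 (by norm_num)
  have h3 : (Real.exp (1 / 40) * √(1 / 2 : ℝ)) ≤ 3 / 4 :=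
    (mul_le_mul h1 h2 (Real.sqrt_nonneg _) (by norm_num)).trans (by norm_num)
  calc (stdGaussian E).real {x | ‖x‖ ^ 2 ≤ (d : ℝ) / 20}
      = Real.exp (1 / 40) ^ d *
        (Real.exp (-(d / 40 : ℝ)) * (stdGaussian E).real {x | ‖x‖ ^ 2 ≤ (d : ℝ) / 20}) := by
        rw [← mul_assoc, ← Real.exp_nat_mul, ← Real.exp_add]
        ring_nf
        simp
    _ ≤ Real.exp (1 / 40) ^ d * √(1 / 2) ^ d := by gcongr
    _ = (Real.exp (1 / 40) * √(1 / 2)) ^ d := (mul_pow ..).symm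
    _ ≤ (Real.exp (1 / 40) * √(1 / 2)) ^ 1 := by
        apply pow_le_pow_of_le_one (by positivity) (h3.trans (by norm_num)) hE
    _ ≤ 3 / 4 := by simpa using h3

end SmallBall

/-! ### Likelihood ratio of two isotropic Gaussian laws -/

section LikelihoodRatio

lemma pi_withDensity_ofReal {ι : Type*} [Fintype ι] {X : ι → Type*} [∀ i, MeasurableSpace (X i)]
    (μ : ∀ i, Measure (X i)) [∀ i, SigmaFinite (μ i)] {f : ∀ i, X i → ℝ}
    (hf : ∀ i, Integrable (f i) (μ i)) (hf0 : ∀ i x, 0 ≤ f i x) :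
    Measure.pi (fun i => (μ i).withDensity fun x => ENNReal.ofReal (f i x)) =
      (Measure.pi μ).withDensity fun x => ENNReal.ofReal (∏ i, f i (x i)) := by
  have (i : ι) : IsFiniteMeasure ((μ i).withDensity fun x => ENNReal.ofReal (f i x)) :=
    isFiniteMeasure_withDensity_ofReal (hf i).2
  refine Measure.pi_eq fun s hs => ?_
  rw [withDensity_apply _ (.univ_pi hs), Measure.restrict_pi_pi,
    ← ofReal_integral_eq_lintegral_ofReal, integral_fintype_prod_eq_prod,
    ENNReal.ofReal_prod_of_nonneg fun i _ => integral_nonneg (hf0 i)]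
  · refine Finset.prod_congr rfl fun i _ => ?_
    rw [withDensity_apply _ (hs i), ofReal_integral_eq_lintegral_ofReal (hf i).restrict
      (ae_of_all _ (hf0 i))]
  · exact Integrable.fintype_prod_dep fun i => (hf i).restrict
  · exact ae_of_all _ fun x => Finset.prod_nonneg fun i _ => hf0 i _

/-- The density of `N(0, 1 + u)` with respect to `N(0, 1)`. -/
noncomputable def varianceRatio (u t : ℝ) : ℝ :=
  √(1 / (1 + u)) * Real.exp (u / (2 * (1 + u)) * t ^ 2)

lemma varianceRatio_nonneg (u t : ℝ) : 0 ≤ varianceRatio u t := by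
  unfold varianceRatio; positivity

lemma map_sqrt_mul_gaussianReal {u : ℝ} (hu : 0 ≤ u) :
    (gaussianReal 0 1).map (√(1 + u) * ·) =
      (gaussianReal 0 1).withDensity fun t => ENNReal.ofReal (varianceRatio u t) := by
  obtain ⟨v, hv⟩ : ∃ v : ℝ≥0, (v : ℝ) = 1 + u := ⟨⟨1 + u, by positivity⟩, rfl⟩
  have hv0 : v ≠ 0 := by
    rintro rfl
    rw [NNReal.coe_zero] at hv
    linarith
  have h1 : (gaussianReal 0 1).map (√(1 + u) * ·) = gaussianReal 0 v := by
    rw [gaussianReal_map_const_mul]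
    congr 1
    · simp
    · ext
      simp [Real.sq_sqrt (show 0 ≤ 1 + u by positivity), hv]
  rw [h1, gaussianReal_of_var_ne_zero _ hv0, gaussianReal_of_var_ne_zero _ one_ne_zero,
    ← withDensity_mul _ (measurable_gaussianPDF _ _) (by unfold varianceRatio; fun_prop)]
  congr 1
  ext t
  simp only [Pi.mul_apply, gaussianPDF]
  rw [← ENNReal.ofReal_mul (gaussianPDFReal_nonneg _ _ _)]
  congr 1
  simp only [gaussianPDFReal, hv, NNReal.coe_one, sub_zero, mul_one, varianceRatio]
  rw [mul_mul_mul_comm, ← Real.exp_add, Real.sqrt_mul (by positivity), mul_inv, one_div,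
    Real.sqrt_inv]
  congr 2
  have : 1 + u ≠ 0 := by positivity
  field_simp
  ring

lemma integral_varianceRatio_sq {u : ℝ} (hu : 0 ≤ u) (hu1 : u < 1) :
    ∫ t, varianceRatio u t ^ 2 ∂(gaussianReal 0 1) = √(1 / (1 - u ^ 2)) := by
  have (t : ℝ) : varianceRatio u t ^ 2 = 1 / (1 + u) * Real.exp (-(-(u / (1 + u))) * t ^ 2) := by
    unfold varianceRatio
    rw [mul_pow, Real.sq_sqrt (by positivity), ← Real.exp_nat_mul]
    congr 2
    field_simp
    push_cast
    ring
  simp_rw [this, integral_const_mul, integral_exp_neg_mul_sq_gaussianReal]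
  have h1 : 0 < 1 + u := by positivity
  have h2 : 0 < 1 - u := by linarith
  rw [show (1 / (1 + u) : ℝ) = √((1 / (1 + u)) ^ 2) from (Real.sqrt_sq (by positivity)).symm,
    ← Real.sqrt_mul (by positivity)]
  congr 1
  have h3 : 1 + 2 * -(u / (1 + u)) = (1 - u) / (1 + u) := by field_simp; ring
  have h4 : 1 - u ^ 2 = (1 - u) * (1 + u) := by ring
  rw [h3, h4]
  field_simp

lemma integrable_varianceRatio_sq {u : ℝ} (hu : 0 ≤ u) (hu1 : u < 1) :
    Integrable (fun t => varianceRatio u t ^ 2) (gaussianReal 0 1) := by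
  refine Integrable.of_integral_ne_zero ?_
  rw [integral_varianceRatio_sq hu hu1]
  exact (Real.sqrt_pos.2 (one_div_pos.2 (by nlinarith))).ne'

lemma integrable_varianceRatio {u : ℝ} (hu : 0 ≤ u) (hu1 : u < 1) :
    Integrable (varianceRatio u) (gaussianReal 0 1) := by
  refine (((integrable_const (1 : ℝ)).add (integrable_varianceRatio_sq hu hu1))).mono'
    (Measurable.aestronglyMeasurable (by unfold varianceRatio; fun_prop)) (ae_of_all _ fun t => ?_)
  rw [Real.norm_eq_abs, abs_of_nonneg (varianceRatio_nonneg u t)]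
  simp only [Pi.add_apply]
  nlinarith [sq_nonneg (varianceRatio u t - 1)]

/-- The likelihood ratio `L` of `N(0, (1 + u) Iₙ)` to `N(0, Iₙ)` satisfies
`E L² = (1 - u²)^(-n/2)`; an event of small probability under the second law thus has small
probability under the first one as long as `n u²` is bounded. Integrating
`L ≤ c / 2 + L² / (2 c)` over the event gives the Cauchy–Schwarz bound, up to the choice
of `c`. -/
lemma stdGaussian_real_preimage_smul_le {n : ℕ} {u c : ℝ} (hu : 0 ≤ u) (hu1 : u < 1) (hc : 0 < c)
    {A : Set (EuclideanSpace ℝ (Fin n))} (hA : MeasurableSet A) :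
    (stdGaussian (EuclideanSpace ℝ (Fin n))).real {e | √(1 + u) • e ∈ A} ≤
      c / 2 * (stdGaussian (EuclideanSpace ℝ (Fin n))).real A +
        1 / (2 * c) * √(1 / (1 - u ^ 2)) ^ n := by
  set μ := Measure.pi fun _ : Fin n => gaussianReal 0 1
  set L : (Fin n → ℝ) → ℝ := fun x => ∏ i, varianceRatio u (x i)
  have hL0 (x) : 0 ≤ L x := Finset.prod_nonneg fun i _ => varianceRatio_nonneg u _
  have hLint : Integrable L μ :=
    Integrable.fintype_prod_dep fun _ => integrable_varianceRatio hu hu1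
  have hL2 (x) : L x ^ 2 = ∏ i, varianceRatio u (x i) ^ 2 := by
    simp only [L, Finset.prod_pow]
  have hL2int : Integrable (fun x => L x ^ 2) μ := by
    simp_rw [hL2]
    exact Integrable.fintype_prod_dep (f := fun _ t => varianceRatio u t ^ 2)
      fun _ => integrable_varianceRatio_sq hu hu1
  have hL2val : ∫ x, L x ^ 2 ∂μ = √(1 / (1 - u ^ 2)) ^ n := by
    simp_rw [hL2]
    rw [integral_fintype_prod_eq_pow (fun t => varianceRatio u t ^ 2),
      integral_varianceRatio_sq hu hu1, Fintype.card_fin]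
  have hm : Measurable (WithLp.toLp 2 : (Fin n → ℝ) → EuclideanSpace ℝ (Fin n)) := by fun_prop
  set B : Set (Fin n → ℝ) := WithLp.toLp 2 ⁻¹' A
  have hB : MeasurableSet B := hm hA
  have hP : (stdGaussian (EuclideanSpace ℝ (Fin n))).real A = μ.real B := by
    rw [← map_pi_eq_stdGaussian, map_measureReal_apply hm hA]
  have hQ : (stdGaussian (EuclideanSpace ℝ (Fin n))).real {e | √(1 + u) • e ∈ A} =
      ∫ x in B, L x ∂μ := by
    have hmap : μ.map (fun x i => √(1 + u) * x i) =
        μ.withDensity fun x => ENNReal.ofReal (L x) := by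
      have (i : Fin n) : IsProbabilityMeasure ((gaussianReal 0 1).map (√(1 + u) * ·)) :=
        Measure.isProbabilityMeasure_map (by fun_prop)
      rw [Measure.pi_map_pi (f := fun _ t => √(1 + u) * t) fun _ => by fun_prop,
        map_sqrt_mul_gaussianReal hu]
      exact pi_withDensity_ofReal _ (fun _ => integrable_varianceRatio hu hu1)
        fun _ => varianceRatio_nonneg u
    have hA' : MeasurableSet {e : EuclideanSpace ℝ (Fin n) | √(1 + u) • e ∈ A} :=
      measurable_const_smul (√(1 + u)) hA
    rw [← map_pi_eq_stdGaussian, map_measureReal_apply hm hA']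
    have : WithLp.toLp 2 ⁻¹' {e : EuclideanSpace ℝ (Fin n) | √(1 + u) • e ∈ A} =
        (fun (x : Fin n → ℝ) i => √(1 + u) * x i) ⁻¹' B := rfl
    rw [this, ← map_measureReal_apply (by fun_prop) hB, hmap, measureReal_def,
      withDensity_apply _ hB, ← ofReal_integral_eq_lintegral_ofReal hLint.restrict
        (ae_of_all _ hL0), ENNReal.toReal_ofReal (integral_nonneg hL0)]
  calc _ = ∫ x in B, L x ∂μ := hQ
    _ ≤ ∫ x in B, (c / 2 + 1 / (2 * c) * L x ^ 2) ∂μ := by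
        refine integral_mono hLint.restrict
          ((integrable_const _).add (hL2int.restrict.const_mul _)) fun x => ?_
        have : c / 2 + 1 / (2 * c) * L x ^ 2 - L x = (c - L x) ^ 2 / (2 * c) := by
          field_simp; ring
        have : 0 ≤ (c - L x) ^ 2 / (2 * c) := by positivity
        simp only
        linarith
    _ = c / 2 * μ.real B + 1 / (2 * c) * ∫ x in B, L x ^ 2 ∂μ := by
        rw [integral_add (integrable_const _) (hL2int.restrict.const_mul _), integral_const_mul,
          integral_const, smul_eq_mul, measureReal_restrict_apply_univ, mul_comm]
    _ ≤ c / 2 * μ.real B + 1 / (2 * c) * ∫ x, L x ^ 2 ∂μ := by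
        gcongr
        · exact ae_of_all _ fun x => sq_nonneg _
        · exact Measure.restrict_le_self
    _ = _ := by rw [hL2val, hP]

end LikelihoodRatio

/-! ### Probabilities of sections and small balls in subspaces -/

section Probability

lemma measureReal_add_measureReal_sub_one_le_inter {Ω : Type*} [MeasurableSpace Ω] (μ : Measure Ω)
    [IsProbabilityMeasure μ] (U : Set Ω) {V : Set Ω} (hV : MeasurableSet V) :
    μ.real U + μ.real V - 1 ≤ μ.real (U ∩ V) := by
  have h1 := measureReal_union_add_inter (μ := μ) (s := U) hV
  have h2 : μ.real (U ∪ V) ≤ 1 := measureReal_le_one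
  linarith

lemma le_measureReal_prod {X Y : Type*} [MeasurableSpace X] [MeasurableSpace Y] {μ : Measure X}
    {ν : Measure Y} [IsProbabilityMeasure μ] [IsProbabilityMeasure ν] {s : Set (X × Y)}
    (hs : MeasurableSet s) {b : ℝ} (h : ∀ x, b ≤ ν.real (Prod.mk x ⁻¹' s)) :
    b ≤ (μ.prod ν).real s := by
  refine (ENNReal.ofReal_le_iff_le_toReal (measure_ne_top _ _)).1 ?_
  rw [Measure.prod_apply hs]
  calc ENNReal.ofReal b = ∫⁻ _, ENNReal.ofReal b ∂μ := by simp
    _ ≤ _ := lintegral_mono fun x =>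
      (ENNReal.ofReal_le_iff_le_toReal (measure_ne_top _ _)).2 (h x)

lemma regressionLaw_real_apply {n : ℕ} (f : EuclideanSpace ℝ (Fin n)) (σ : ℝ)
    {A : Set (EuclideanSpace ℝ (Fin n))} (hA : MeasurableSet A) :
    (regressionLaw f σ).real A =
      (stdGaussian (EuclideanSpace ℝ (Fin n))).real {e | f + σ • e ∈ A} :=
  map_measureReal_apply (by fun_prop) hA

/-- The strict inequality forces `0 < k` and a positive dimension. -/
lemma stdGaussian_mul_norm_sq_le {E : Type*} [NormedAddCommGroup E] [InnerProductSpace ℝ E]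
    [FiniteDimensional ℝ E] [MeasurableSpace E] [BorelSpace E] {k r : ℝ}
    (h : 80 * r ^ 2 < k * Module.finrank ℝ E) :
    (stdGaussian E).real {x | k * ‖x‖ ^ 2 ≤ 4 * r ^ 2} ≤ 3 / 4 := by
  have hk : 0 < k := by
    by_contra hk
    have : k * Module.finrank ℝ E ≤ 0 :=
      mul_nonpos_of_nonpos_of_nonneg (not_lt.1 hk) (by positivity)
    nlinarith [sq_nonneg r]
  have hE : 0 < Module.finrank ℝ E := by
    rw [Nat.pos_iff_ne_zero]
    intro h0
    rw [h0] at h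
    simp at h
    nlinarith [sq_nonneg r]
  refine (measureReal_mono fun x (hx : k * ‖x‖ ^ 2 ≤ 4 * r ^ 2) => ?_).trans
    (stdGaussian_norm_sq_le_finrank hE)
  have : k * ‖x‖ ^ 2 ≤ k * (Module.finrank ℝ E / 20) := by linarith
  exact le_of_mul_le_mul_left this hk

/-- The projection of the difference of two independent standard Gaussian vectors is `√2` times
a standard Gaussian vector of `S`. -/
lemma stdGaussian_prod_orthogonalProjectionOnto_sub_le {E : Type*} [NormedAddCommGroup E]
    [InnerProductSpace ℝ E] [FiniteDimensional ℝ E] [MeasurableSpace E] [BorelSpace E]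
    (S : Submodule ℝ E) {k r : ℝ} (h : 40 * r ^ 2 < k * Module.finrank ℝ S) :
    ((stdGaussian E).prod (stdGaussian E)).real
      {p | k * ‖S.orthogonalProjectionOnto (p.1 - p.2)‖ ^ 2 ≤ 4 * r ^ 2} ≤ 3 / 4 := by
  have hZ : MeasurableSet {z : E | k * ‖S.orthogonalProjectionOnto z‖ ^ 2 ≤ 4 * r ^ 2} :=
    measurableSet_le (by fun_prop) (by fun_prop)
  have hsub : {p : E × E | k * ‖S.orthogonalProjectionOnto (p.1 - p.2)‖ ^ 2 ≤ 4 * r ^ 2} =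
      (fun p : E × E => (1 : ℝ) • p.1 + (-1 : ℝ) • p.2) ⁻¹'
        {z | k * ‖S.orthogonalProjectionOnto z‖ ^ 2 ≤ 4 * r ^ 2} := by
    ext p
    have h3 : (1 : ℝ) • p.1 + (-1 : ℝ) • p.2 = p.1 - p.2 := by module
    rw [Set.mem_preimage, Set.mem_ofPred_eq, Set.mem_ofPred_eq, h3]
  have hpre : (fun e : E => √((1 : ℝ) ^ 2 + (-1) ^ 2) • e) ⁻¹'
        {z | k * ‖S.orthogonalProjectionOnto z‖ ^ 2 ≤ 4 * r ^ 2} =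
      S.orthogonalProjectionOnto ⁻¹' {x | 2 * k * ‖x‖ ^ 2 ≤ 4 * r ^ 2} := by
    ext e
    rw [Set.mem_preimage, Set.mem_preimage, Set.mem_ofPred_eq, Set.mem_ofPred_eq, map_smul,
      norm_smul, mul_pow, Real.norm_eq_abs, sq_abs, Real.sq_sqrt (by norm_num)]
    ring_nf
  rw [hsub, ← map_measureReal_apply (by fun_prop) hZ, map_smul_add_smul_stdGaussian_prod,
    map_measureReal_apply (by fun_prop) hZ, hpre, ← map_measureReal_apply (by fun_prop)
      (measurableSet_le (by fun_prop) (by fun_prop)), map_orthogonalProjectionOnto_stdGaussian]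
  apply stdGaussian_mul_norm_sq_le
  linarith

end Probability

/-! ### Confidence balls -/

section ConfidenceBall

variable {n : ℕ} {η τ α β : ℝ} {ftilde : EuclideanSpace ℝ (Fin n) → EuclideanSpace ℝ (Fin n)}
  {rtilde : EuclideanSpace ℝ (Fin n) → ℝ≥0}

/-- The observations `y` for which the confidence ball contains `f` and has radius at most `r`. -/
def goodSet (ftilde : EuclideanSpace ℝ (Fin n) → EuclideanSpace ℝ (Fin n))
    (rtilde : EuclideanSpace ℝ (Fin n) → ℝ≥0) (f : EuclideanSpace ℝ (Fin n)) (r : ℝ) :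
    Set (EuclideanSpace ℝ (Fin n)) :=
  {y | f ∈ Metric.closedBall (ftilde y) (rtilde y : ℝ)} ∩ {y | (rtilde y : ℝ) ≤ r}

lemma measurableSet_goodSet (hf : Measurable ftilde) (hr : Measurable rtilde)
    (f : EuclideanSpace ℝ (Fin n)) (r : ℝ) : MeasurableSet (goodSet ftilde rtilde f r) :=
  (measurableSet_le (f := fun y => dist f (ftilde y)) (by fun_prop) (by fun_prop)).inter
    (measurableSet_le (by fun_prop) (by fun_prop))

lemma norm_sub_le_of_mem_goodSet {f g y : EuclideanSpace ℝ (Fin n)} {r : ℝ}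
    (hf : y ∈ goodSet ftilde rtilde f r)
    (hg : g ∈ Metric.closedBall (ftilde y) (rtilde y : ℝ)) : ‖g - f‖ ≤ 2 * r := by
  obtain ⟨h1, h2⟩ := hf
  rw [Metric.mem_closedBall] at hg
  rw [Set.mem_ofPred_eq, Metric.mem_closedBall] at h1
  rw [Set.mem_ofPred_eq] at h2
  rw [← dist_eq_norm]
  linarith [dist_triangle_right g f (ftilde y)]

lemma le_stdGaussian_real_goodSet (hf : Measurable ftilde) (hr : Measurable rtilde)
    (hcov : HasCoverage η τ β ftilde rtilde) {f : EuclideanSpace ℝ (Fin n)} {r σ : ℝ}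
    (hσ : σ ∈ noiseInterval η τ)
    (hrad : 1 - α ≤ (regressionLaw f σ).real {y | (rtilde y : ℝ) ≤ r}) :
    1 - α - β ≤ (stdGaussian (EuclideanSpace ℝ (Fin n))).real
      {e | f + σ • e ∈ goodSet ftilde rtilde f r} := by
  rw [← regressionLaw_real_apply f σ (measurableSet_goodSet hf hr f r)]
  have := measureReal_add_measureReal_sub_one_le_inter (regressionLaw f σ)
    {y | f ∈ Metric.closedBall (ftilde y) (rtilde y : ℝ)}
    (V := {y | (rtilde y : ℝ) ≤ r}) (measurableSet_le (by fun_prop) (by fun_prop))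
  have h2 := hcov f σ hσ
  unfold goodSet
  linarith

/-- If the mean is `f + a ξ` with `ξ` standard Gaussian and the noise level is `σ`, then the
observation has mean `f` and noise level `√(a² + σ²)`. A ball of radius at most `r` which contains
both `f` and the true mean `f + a ξ` forces `‖a ξ‖ ≤ 2 r`. -/
lemma stdGaussian_real_goodSet_le (hf : Measurable ftilde) (hr : Measurable rtilde)
    (hcov : HasCoverage η τ β ftilde rtilde) (f : EuclideanSpace ℝ (Fin n)) (a r : ℝ) {σ : ℝ}
    (hσ : σ ∈ noiseInterval η τ) :
    (stdGaussian (EuclideanSpace ℝ (Fin n))).real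
        {e | f + √(a ^ 2 + σ ^ 2) • e ∈ goodSet ftilde rtilde f r} ≤
      β + (stdGaussian (EuclideanSpace ℝ (Fin n))).real {x | a ^ 2 * ‖x‖ ^ 2 ≤ 4 * r ^ 2} := by
  set γ := stdGaussian (EuclideanSpace ℝ (Fin n))
  set A := goodSet ftilde rtilde f r
  have hA : MeasurableSet A := measurableSet_goodSet hf hr f r
  set V := {p : EuclideanSpace ℝ (Fin n) × EuclideanSpace ℝ (Fin n) |
    dist (f + a • p.1) (ftilde (f + a • p.1 + σ • p.2)) ≤ rtilde (f + a • p.1 + σ • p.2)}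
  have hV : MeasurableSet V := measurableSet_le (by fun_prop) (by fun_prop)
  have hVβ : 1 - β ≤ (γ.prod γ).real V := by
    refine le_measureReal_prod hV fun x => ?_
    have hm : MeasurableSet {y | f + a • x ∈ Metric.closedBall (ftilde y) (rtilde y : ℝ)} :=
      measurableSet_le (f := fun y => dist (f + a • x) (ftilde y)) (by fun_prop) (by fun_prop)
    have := hcov (f + a • x) σ hσ
    rwa [regressionLaw_real_apply _ _ hm] at this
  have hVc : (γ.prod γ).real Vᶜ ≤ β := by
    rw [probReal_compl_eq_one_sub hV]
    linarith
  have hB : MeasurableSet {y | f + y ∈ A} := hA.preimage (measurable_const_add f)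
  have hlaw : γ.real {e | f + √(a ^ 2 + σ ^ 2) • e ∈ A} =
      (γ.prod γ).real {p | f + (a • p.1 + σ • p.2) ∈ A} := by
    have h1 := map_measureReal_apply (μ := γ) (f := fun e => √(a ^ 2 + σ ^ 2) • e)
      (by fun_prop) hB
    have h2 := map_measureReal_apply (μ := γ.prod γ) (f := fun p => a • p.1 + σ • p.2)
      (by fun_prop) hB
    rw [map_smul_add_smul_stdGaussian_prod] at h2
    exact h1.symm.trans h2
  have hsub : {p : EuclideanSpace ℝ (Fin n) × EuclideanSpace ℝ (Fin n) |
      f + (a • p.1 + σ • p.2) ∈ A} ⊆ Vᶜ ∪ {x | a ^ 2 * ‖x‖ ^ 2 ≤ 4 * r ^ 2} ×ˢ Set.univ := by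
    intro p (hp : f + (a • p.1 + σ • p.2) ∈ A)
    by_cases hpV : p ∈ V
    · refine Or.inr ⟨?_, trivial⟩
      rw [← add_assoc] at hp
      have := norm_sub_le_of_mem_goodSet hp hpV
      rw [add_sub_cancel_left, norm_smul, Real.norm_eq_abs] at this
      have h2 := pow_le_pow_left₀ (by positivity) this 2
      rw [mul_pow, sq_abs] at h2
      rw [Set.mem_ofPred_eq]
      linarith
    · exact Or.inl hpV
  rw [hlaw]
  refine (measureReal_mono hsub).trans ((measureReal_union_le _ _).trans (add_le_add hVc ?_))
  rw [measureReal_prod_prod]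
  simp

/-- Noise of level `τ` at `f` has the same law as noise of level `√(1-η) τ` around the random mean
`f + √η τ ξ`. -/
lemma eta_mul_le_sq_radius (hη : η ∈ Set.Ico (0 : ℝ) 1) (hτ : 0 ≤ τ)
    (hαβ : 2 * β + α < 1 / 36) (hf : Measurable ftilde) (hr : Measurable rtilde)
    (hcov : HasCoverage η τ β ftilde rtilde) (f : EuclideanSpace ℝ (Fin n)) (r : ℝ)
    (hrad : 1 - α ≤ (regressionLaw f τ).real {y | (rtilde y : ℝ) ≤ r}) :
    η * n * τ ^ 2 ≤ 80 * r ^ 2 := by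
  by_contra! hlt
  have h1η : √(1 - η) ^ 2 = 1 - η := Real.sq_sqrt (by linarith [hη.2])
  have hle : √(1 - η) * τ ≤ τ :=
    mul_le_of_le_one_left hτ (Real.sqrt_le_one.2 (by linarith [hη.1]))
  have h1 := le_stdGaussian_real_goodSet hf hr hcov ⟨hle, le_rfl⟩ hrad
  have h2 := stdGaussian_real_goodSet_le hf hr hcov f (√η * τ) r
    (σ := √(1 - η) * τ) ⟨le_rfl, hle⟩
  have hsq : (√η * τ) ^ 2 = η * τ ^ 2 := by rw [mul_pow, Real.sq_sqrt hη.1]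
  have hsum : √((√η * τ) ^ 2 + (√(1 - η) * τ) ^ 2) = τ := by
    rw [hsq, mul_pow, h1η, ← Real.sqrt_sq hτ, Real.sq_sqrt (sq_nonneg τ)]
    ring_nf
  have h3 : (stdGaussian (EuclideanSpace ℝ (Fin n))).real
      {x | (√η * τ) ^ 2 * ‖x‖ ^ 2 ≤ 4 * r ^ 2} ≤ 3 / 4 := by
    apply stdGaussian_mul_norm_sq_le
    rw [hsq, finrank_euclideanSpace_fin]
    linarith
  rw [hsum] at h2
  linarith

/-- The random mean `f + √u τ ξ` multiplies the noise variance by `1 + u`, which cannot be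
detected from `n` coordinates when `u` is of order `1 / √n`. -/
lemma sqrt_mul_le_sq_radius (hη : η ∈ Set.Ico (0 : ℝ) 1) (hτ : 0 ≤ τ) (hβ : 0 < β)
    (hαβ : 2 * β + α < 1 / 36) (hf : Measurable ftilde) (hr : Measurable rtilde)
    (hcov : HasCoverage η τ β ftilde rtilde) (f : EuclideanSpace ℝ (Fin n)) (r : ℝ)
    (hrad : 1 - α ≤ (regressionLaw f τ).real {y | (rtilde y : ℝ) ≤ r}) :
    √n * τ ^ 2 ≤ 160 * r ^ 2 := by
  rcases Nat.eq_zero_or_pos n with rfl | hn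
  · simp; positivity
  by_contra! hlt
  have hn1 : (1 : ℝ) ≤ n := by exact_mod_cast hn
  have hs1 : 1 ≤ √(n : ℝ) := Real.one_le_sqrt.2 hn1
  have hs2 : √(n : ℝ) ^ 2 = n := Real.sq_sqrt (by positivity)
  set s := √(n : ℝ)
  -- With this `u`, `n u² = 1/4` keeps the second moment of the likelihood ratio below `4/3`.
  set u : ℝ := 1 / (2 * s)
  have hu0 : 0 ≤ u := by positivity
  have hu1 : u < 1 := by
    rw [div_lt_one (by positivity)]
    linarith
  have hτI : τ ∈ noiseInterval η τ :=
    ⟨mul_le_of_le_one_left hτ (Real.sqrt_le_one.2 (by linarith [hη.1])), le_rfl⟩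
  have h1 := le_stdGaussian_real_goodSet hf hr hcov hτI hrad
  have h2 := stdGaussian_real_goodSet_le hf hr hcov f (√u * τ) r hτI
  set γ := stdGaussian (EuclideanSpace ℝ (Fin n))
  have hsq : (√u * τ) ^ 2 = u * τ ^ 2 := by rw [mul_pow, Real.sq_sqrt hu0]
  have hsum : √((√u * τ) ^ 2 + τ ^ 2) = τ * √(1 + u) := by
    rw [hsq, show u * τ ^ 2 + τ ^ 2 = τ ^ 2 * (1 + u) by ring, Real.sqrt_mul (sq_nonneg τ),
      Real.sqrt_sq hτ]
  have h3 : γ.real {x | (√u * τ) ^ 2 * ‖x‖ ^ 2 ≤ 4 * r ^ 2} ≤ 3 / 4 := by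
    apply stdGaussian_mul_norm_sq_le
    rw [hsq, finrank_euclideanSpace_fin, ← hs2]
    have : u * τ ^ 2 * s ^ 2 = s * τ ^ 2 / 2 := by
      simp only [u]
      field_simp
    linarith
  have hK : √(1 / (1 - u ^ 2)) ^ n ≤ 4 / 3 := by
    have hu2 : u ^ 2 = 1 / (4 * n) := by
      simp only [u]
      rw [div_pow, mul_pow, hs2]
      norm_num
    have hpos : 0 < 1 - u ^ 2 := by nlinarith
    -- Bernoulli's inequality.
    have hbern : 3 / 4 ≤ (1 - u ^ 2) ^ n := by
      have h := one_add_mul_le_pow (a := -u ^ 2) (by nlinarith) n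
      have h' : (n : ℝ) * -u ^ 2 = -(1 / 4) := by
        rw [hu2]
        field_simp
      rw [h'] at h
      rw [sub_eq_add_neg]
      linarith
    have hle : √(1 / (1 - u ^ 2)) ≤ 1 / (1 - u ^ 2) := by
      rw [Real.sqrt_le_left (by positivity)]
      have : 1 ≤ 1 / (1 - u ^ 2) := by
        rw [le_div_iff₀ hpos]
        nlinarith
      nlinarith
    calc √(1 / (1 - u ^ 2)) ^ n ≤ (1 / (1 - u ^ 2)) ^ n := by gcongr
      _ = 1 / (1 - u ^ 2) ^ n := by rw [one_div_pow]
      _ ≤ 1 / (3 / 4) := by gcongr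
      _ = 4 / 3 := by norm_num
  set A := {e | f + τ • e ∈ goodSet ftilde rtilde f r}
  have hA : MeasurableSet A :=
    (measurableSet_goodSet hf hr f r).preimage (f := fun e => f + τ • e) (by fun_prop)
  -- `c = 7` nearly minimizes `c / 2 * (1 / 36) + (4 / 3) / (2 * c)`, whose value is below `1/5`.
  have h4 := stdGaussian_real_preimage_smul_le hu0 hu1 (c := 7) (by norm_num) hA.compl
  have hAscale : MeasurableSet {e | √(1 + u) • e ∈ A} := hA.preimage (measurable_const_smul _)
  have hcompl : {e | √(1 + u) • e ∈ Aᶜ} = {e | √(1 + u) • e ∈ A}ᶜ := rfl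
  rw [hcompl, probReal_compl_eq_one_sub hAscale, probReal_compl_eq_one_sub hA] at h4
  have h5 : {e | f + √((√u * τ) ^ 2 + τ ^ 2) • e ∈ goodSet ftilde rtilde f r} =
      {e | √(1 + u) • e ∈ A} := by
    ext e
    simp only [A, Set.mem_ofPred_eq, hsum, smul_smul]
  rw [h5] at h2
  linarith

/-- Under a Gaussian prior on `S`, each observation comes with an exchangeable pair of means in
`S`, both lying in the confidence ball with large probability; their distance is
of order `√(dim S) τ`. -/
lemma finrank_mul_le_sq_radius (hη : η ∈ Set.Ico (0 : ℝ) 1) (hτ : 0 ≤ τ) (hβ : 0 < β)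
    (hαβ : 2 * β + α < 1 / 36) (hf : Measurable ftilde) (hr : Measurable rtilde)
    (hcov : HasCoverage η τ β ftilde rtilde) (S : Submodule ℝ (EuclideanSpace ℝ (Fin n))) (r : ℝ)
    (hrad : ∀ f ∈ S, 1 - α ≤ (regressionLaw f τ).real {y | (rtilde y : ℝ) ≤ r}) :
    Module.finrank ℝ S * τ ^ 2 ≤ 40 * r ^ 2 := by
  by_contra! hlt
  have hτI : τ ∈ noiseInterval η τ :=
    ⟨mul_le_of_le_one_left hτ (Real.sqrt_le_one.2 (by linarith [hη.1])), le_rfl⟩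
  set γ := stdGaussian (EuclideanSpace ℝ (Fin n))
  set U := {p : EuclideanSpace ℝ (Fin n) × EuclideanSpace ℝ (Fin n) |
    τ • S.starProjection p.1 + τ • p.2 ∈ goodSet ftilde rtilde (τ • S.starProjection p.1) r}
  have hU : MeasurableSet U :=
    (measurableSet_le
      (f := fun p : EuclideanSpace ℝ (Fin n) × EuclideanSpace ℝ (Fin n) =>
        dist (τ • S.starProjection p.1) (ftilde (τ • S.starProjection p.1 + τ • p.2)))
      (g := fun p => (rtilde (τ • S.starProjection p.1 + τ • p.2) : ℝ))
      (by fun_prop) (by fun_prop)).inter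
    (measurableSet_le
      (f := fun p : EuclideanSpace ℝ (Fin n) × EuclideanSpace ℝ (Fin n) =>
        (rtilde (τ • S.starProjection p.1 + τ • p.2) : ℝ)) (by fun_prop) (by fun_prop))
  have hUprob : 1 - α - β ≤ (γ.prod γ).real U := by
    refine le_measureReal_prod hU fun x => ?_
    have hx := le_stdGaussian_real_goodSet hf hr hcov hτI
      (hrad _ (S.smul_mem τ (S.starProjection_apply_mem x)))
    exact hx
  have hU'prob : 1 - α - β ≤ (γ.prod γ).real (swapComponents S ⁻¹' U) := by
    rwa [← map_measureReal_apply (by fun_prop) hU, map_swapComponents_stdGaussian_prod]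
  have hinter := measureReal_add_measureReal_sub_one_le_inter (γ.prod γ) U
    (hU.preimage (by fun_prop : Measurable (swapComponents S)))
  have hsub : U ∩ swapComponents S ⁻¹' U ⊆
      {p | τ ^ 2 * ‖S.orthogonalProjectionOnto (p.1 - p.2)‖ ^ 2 ≤ 4 * r ^ 2} := by
    rintro p ⟨hp, hp'⟩
    have hp'' : τ • S.starProjection (swapComponents S p).1 + τ • (swapComponents S p).2 ∈
        goodSet ftilde rtilde (τ • S.starProjection (swapComponents S p).1) r := hp'
    rw [← smul_add, starProjection_fst_add_snd_swapComponents, starProjection_fst_swapComponents,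
      smul_add] at hp''
    have := norm_sub_le_of_mem_goodSet hp'' hp.1
    rw [← smul_sub, ← map_sub, norm_smul, Real.norm_eq_abs] at this
    have h2 := pow_le_pow_left₀ (by positivity) this 2
    rw [mul_pow, sq_abs] at h2
    have h4 : ‖S.orthogonalProjectionOnto (p.1 - p.2)‖ = ‖S.starProjection (p.1 - p.2)‖ := rfl
    rw [Set.mem_ofPred_eq, h4]
    linarith
  have hsmall := stdGaussian_prod_orthogonalProjectionOnto_sub_le S (k := τ ^ 2) (r := r)
    (by linarith)
  have := (measureReal_mono (μ := γ.prod γ) hsub).trans hsmall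
  linarith

end ConfidenceBall

theorem theorem3p1 (α β : ℝ) (hα : α ∈ Set.Ioo (0 : ℝ) 1) (hβ : β ∈ Set.Ioo (0 : ℝ) 1)
    (hαβ : 2 * β + α < 1 - Real.exp (-(1 / 36 : ℝ))) :
    ∃ C : ℝ, 0 < C ∧
      ∀ (n : ℕ) (η τ : ℝ), η ∈ Set.Ico (0 : ℝ) 1 → 0 ≤ τ →
      ∀ (ftilde : EuclideanSpace ℝ (Fin n) → EuclideanSpace ℝ (Fin n))
        (rtilde : EuclideanSpace ℝ (Fin n) → ℝ≥0),
        Measurable ftilde → Measurable rtilde → HasCoverage η τ β ftilde rtilde →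
        (∀ (S : Submodule ℝ (EuclideanSpace ℝ (Fin n))) (r : ℝ),
          (∀ σ ∈ noiseInterval η τ, ∀ f ∈ S,
            1 - α ≤ (regressionLaw f σ).real {y | (rtilde y : ℝ) ≤ r}) →
          C * max (max (η * ((n : ℝ) - (Module.finrank ℝ S : ℝ))) (Module.finrank ℝ S : ℝ))
              (Real.sqrt ((n : ℝ) - (Module.finrank ℝ S : ℝ))) * τ ^ 2 ≤ r ^ 2) ∧
        (∀ (f : EuclideanSpace ℝ (Fin n)) (r : ℝ),
          (∀ σ ∈ noiseInterval η τ,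
            1 - α ≤ (regressionLaw f σ).real {y | (rtilde y : ℝ) ≤ r}) →
          C * max (η * (n : ℝ)) (Real.sqrt (n : ℝ)) * τ ^ 2 ≤ r ^ 2) := by
  have hαβ' : 2 * β + α < 1 / 36 := by linarith [Real.add_one_le_exp (-(1 / 36 : ℝ))]
  refine ⟨1 / 160, by norm_num, fun n η τ hη hτ ftilde rtilde hf hr hcov => ?_⟩
  have hτI : τ ∈ noiseInterval η τ :=
    ⟨mul_le_of_le_one_left hτ (Real.sqrt_le_one.2 (by linarith [hη.1])), le_rfl⟩
  have hpoint (f : EuclideanSpace ℝ (Fin n)) (r : ℝ)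
      (hrad : 1 - α ≤ (regressionLaw f τ).real {y | (rtilde y : ℝ) ≤ r}) :
      max (η * (n : ℝ)) (√(n : ℝ)) * τ ^ 2 ≤ 160 * r ^ 2 := by
    have h1 := eta_mul_le_sq_radius hη hτ hαβ' hf hr hcov f r hrad
    have h2 := sqrt_mul_le_sq_radius hη hτ hβ.1 hαβ' hf hr hcov f r hrad
    rw [max_mul_of_nonneg _ _ (sq_nonneg τ)]
    exact max_le (by linarith [sq_nonneg r]) h2
  refine ⟨fun S r hS => ?_, fun f r hfr => by linarith [hpoint f r (hfr τ hτI)]⟩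
  -- As `0 ∈ S`, the pointwise bound at `f = 0` gives the terms in `n`, which dominate those in
  -- `n - dim S`.
  have h0 := hpoint 0 r (hS τ hτI 0 S.zero_mem)
  have hD := finrank_mul_le_sq_radius hη hτ hβ.1 hαβ' hf hr hcov S r (hS τ hτI)
  have hle : (n : ℝ) - Module.finrank ℝ S ≤ n := by
    linarith [(Nat.cast_nonneg (Module.finrank ℝ S) : (0 : ℝ) ≤ _)]
  have hmax : max (max (η * ((n : ℝ) - Module.finrank ℝ S)) (Module.finrank ℝ S : ℝ))
        √((n : ℝ) - Module.finrank ℝ S) ≤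
      max (max (η * (n : ℝ)) √(n : ℝ)) (Module.finrank ℝ S : ℝ) := by
    refine max_le (max_le ?_ (le_max_right _ _)) ?_
    · exact (mul_le_mul_of_nonneg_left hle hη.1).trans ((le_max_left _ _).trans (le_max_left _ _))
    · exact (Real.sqrt_le_sqrt hle).trans ((le_max_right _ _).trans (le_max_left _ _))
  have hτ2 := mul_le_mul_of_nonneg_right hmax (sq_nonneg τ)
  have : max (max (η * (n : ℝ)) √(n : ℝ)) (Module.finrank ℝ S : ℝ) * τ ^ 2 ≤ 160 * r ^ 2 := by
    rw [max_mul_of_nonneg _ _ (sq_nonneg τ)]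
    exact max_le h0 (by linarith [sq_nonneg r])
  linarith
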